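/- Let $\mathcal H$ be a finite-dimensional complex Hilbert space, $\Omega$ a finite set and $\{C_\omega\}_{\omega\in\Omega}$ an instrument on $\mathcal H$: each $C_\omega$ is a completely positive map on the matrices on $\mathcal H$, and $\Lambda:=\sum_\omega C_\omega$ is trace-preserving. Assume that $\Lambda$ is irreducible, i.e. whenever a state $\sigma$ (positive semi-definite matrix of trace one) and a real $\alpha\ge 0$ satisfy $\Lambda(\sigma)\le\alpha\sigma$, then $\sigma$ is strictly positive definite. Let $x_\omega\in\mathbb R$ for $\omega\in\Omega$, let $\lambda_\theta$ be the Perron–Frobenius eigenvalue (the spectral radius) of $\Lambda_\theta:=\sum_\omega e^{\theta x_\omega}C_\omega$, and let $\phi(\theta):=\log\lambda_\theta$ for $\theta\in\mathbb R$. For an arbitrary initial state $\rho$, let $\omega_1,\dots,\omega_n$ be the outcomes observed with probability $\operatorname{Tr} C_{\omega_n}\circ\cdots\circ C_{\omega_1}(\rho)$, put $X_i:=x_{\omega_i}$ and let $X^n:=\frac1n\sum_{i=1}^n X_i$ be the sample mean. Then $\phi$ is twice continuously differentiable at $0$ with $\phi''(0)\ge 0$, and: (1) $X^n$ converges to $\phi'(0)$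 in probability, i.e. $\lim_{n\to\infty}\Pr\{|X^n-\phi'(0)|\ge\varepsilon\}=0$ for every $\varepsilon>0$; (2) $\sqrt n\,(X^n-\phi'(0))$ converges in distribution to the centered Gaussian distribution with variance $\phi''(0)$ (the point mass at $0$ if $\phi''(0)=0$). In terms of distribution functions, with $\Phi(y):=\int_{-\infty}^y \frac{e^{-t^2/2}}{\sqrt{2\pi}}\,dt$, $$\lim_{n\to\infty}\Pr\{\sqrt n\,(X^n-\phi'(0))\le\delta\}=\Phi\Bigl(\frac{\delta}{\sqrt{\phi''(0)}}\Bigr)$$ for every $\delta\in\mathbb R$ if $\phi''(0)>0$; if $\phi''(0)=0$, the limit is $1$ for $\delta>0$ and $0$ for $\delta<0$. -/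

import Mathlib

open scoped ComplexOrder

noncomputable section

namespace QuantumHMM

open Matrix MeasureTheory

variable {ι Ω : Type*} [Fintype ι] [Fintype Ω]

/-- The ampliation `id_k ⊗ Λ`: apply `Λ` to every `ι × ι` block of a matrix with rows and columns
indexed by `Fin k × ι`. -/
def ampliation (k : ℕ) (Λ : Matrix ι ι ℂ →ₗ[ℂ] Matrix ι ι ℂ)
    (M : Matrix (Fin k × ι) (Fin k × ι) ℂ) : Matrix (Fin k × ι) (Fin k × ι) ℂ :=
  fun p q => Λ (fun a b => M (p.1, a) (q.1, b)) p.2 q.2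

/-- `Λ` is completely positive: every `id_k ⊗ Λ` maps positive semi-definite matrices to positive
semi-definite matrices. -/
def IsCompletelyPositive (Λ : Matrix ι ι ℂ →ₗ[ℂ] Matrix ι ι ℂ) : Prop :=
  ∀ (k : ℕ) (M : Matrix (Fin k × ι) (Fin k × ι) ℂ), M.PosSemidef → (ampliation k Λ M).PosSemidef

/-- A state: a positive semi-definite matrix of trace one. -/
structure DensityMatrix (ι : Type*) [Fintype ι] where
  /-- the underlying matrix -/
  mat : Matrix ι ι ℂ
  posSemidef : mat.PosSemidef
  trace_eq_one : mat.trace = 1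

/-- An instrument with outcomes in `Ω`: completely positive maps whose sum preserves the trace. -/
structure Instrument (Ω ι : Type*) [Fintype Ω] [Fintype ι] where
  /-- the map `C_ω` attached to the outcome `ω` -/
  map : Ω → (Matrix ι ι ℂ →ₗ[ℂ] Matrix ι ι ℂ)
  completelyPositive : ∀ ω, IsCompletelyPositive (map ω)
  tracePreserving : ∀ M, ((∑ ω, map ω) M).trace = M.trace

/-- A completely positive map `Λ` is irreducible: if a state `ρ` satisfies `Λ ρ ≤ α ρ` for some
`α ≥ 0`, then `ρ` is strictly positive definite. -/
def IsIrreducible (Λ : Matrix ι ι ℂ →ₗ[ℂ] Matrix ι ι ℂ) : Prop :=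
  ∀ (ρ : DensityMatrix ι) (α : ℝ), 0 ≤ α →
    ((α : ℂ) • ρ.mat - Λ ρ.mat).PosSemidef → ρ.mat.PosDef

namespace Instrument

variable (C : Instrument Ω ι)

/-- The total map `Λ = ∑ ω, C_ω`. -/
def total : Matrix ι ι ℂ →ₗ[ℂ] Matrix ι ι ℂ := ∑ ω, C.map ω

/-- The tilted map `Λ_θ = ∑ ω, exp (θ x_ω) C_ω`. -/
def tilted (x : Ω → ℝ) (θ : ℝ) : Matrix ι ι ℂ →ₗ[ℂ] Matrix ι ι ℂ :=
  ∑ ω, (Real.exp (θ * x ω) : ℂ) • C.map ω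

/-- The Perron-Frobenius eigenvalue `λ_θ` of `Λ_θ`, i.e. its spectral radius. -/
def pfEigenvalue (x : Ω → ℝ) (θ : ℝ) : ℝ :=
  (spectralRadius ℂ (C.tilted x θ : Module.End ℂ (Matrix ι ι ℂ))).toReal

/-- `φ(θ) = log λ_θ`. -/
def phi (x : Ω → ℝ) (θ : ℝ) : ℝ := Real.log (C.pfEigenvalue x θ)

/-- `(C_{ω_n} ∘ ⋯ ∘ C_{ω_1}) M`, where `ω_1, …, ω_n` are the entries of `w`, first one first. -/
def evolve : (n : ℕ) → (Fin n → Ω) → Matrix ι ι ℂ → Matrix ι ι ℂ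
  | 0, _, M => M
  | n + 1, w, M => C.map (w (Fin.last n)) (evolve n (fun i => w i.castSucc) M)

lemma map_posSemidef (ω : Ω) {M : Matrix ι ι ℂ} (hM : M.PosSemidef) :
    (C.map ω M).PosSemidef := by
  have h := C.completelyPositive ω 1 (M.submatrix Prod.snd Prod.snd) (hM.submatrix _)
  exact h.submatrix (fun a : ι => ((0 : Fin 1), a))

lemma evolve_posSemidef (n : ℕ) (w : Fin n → Ω) {M : Matrix ι ι ℂ} (hM : M.PosSemidef) :
    (C.evolve n w M).PosSemidef := by
  induction n with
  | zero => exact hM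
  | succ n ih => exact C.map_posSemidef _ (ih _)

lemma sum_trace_evolve (n : ℕ) (M : Matrix ι ι ℂ) :
    ∑ w : Fin n → Ω, (C.evolve n w M).trace = M.trace := by
  induction n with
  | zero => simp [evolve]
  | succ n ih =>
    rw [← (Fin.snocEquiv fun _ : Fin (n + 1) => Ω).sum_comp, Fintype.sum_prod_type_right, ← ih]
    refine Finset.sum_congr rfl fun w _ => ?_
    rw [← C.tracePreserving, LinearMap.sum_apply, Matrix.trace_sum]
    simp [evolve, Fin.snocEquiv]

/-- The joint law of the first `n` outcomes when the initial state is `ρ`: the sequence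
`ω_1, …, ω_n` has probability `Tr (C_{ω_n} ∘ ⋯ ∘ C_{ω_1}) ρ`. -/
def outcomeLaw (ρ : DensityMatrix ι) (n : ℕ) : PMF (Fin n → Ω) :=
  PMF.ofFintype (fun w => ENNReal.ofReal (C.evolve n w ρ.mat).trace.re) (by
    have h0 : ∀ w ∈ (Finset.univ : Finset (Fin n → Ω)), 0 ≤ (C.evolve n w ρ.mat).trace.re :=
      fun w _ => (Complex.nonneg_iff.1 (C.evolve_posSemidef n w ρ.posSemidef).trace_nonneg).1
    rw [← ENNReal.ofReal_sum_of_nonneg h0, ← Complex.re_sum, C.sum_trace_evolve, ρ.trace_eq_one]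
    simp)

end Instrument

/-- The sample mean `X^n = (1/n) ∑ i, X_i`, where `X_i = x_{ω_i}`. -/
def sampleMean (x : Ω → ℝ) (n : ℕ) (w : Fin n → Ω) : ℝ := (1 / (n : ℝ)) * ∑ i, x (w i)

/-- The standard normal distribution function. -/
def stdNormalCDF (y : ℝ) : ℝ :=
  ∫ t in Set.Iic y, Real.exp (-t ^ 2 / 2) / Real.sqrt (2 * Real.pi)

end QuantumHMM

end

/-! The characteristic function at `t` of `√n (X^n - m)` is `exp (-i t √n m) · Tr Λ_z^n ρ` with `z =
i t / √n` (`charFun_outcomeLaw`), so everything rests on the powers of `Λ_z` for small imaginary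
`z`.

Irreducibility makes the invariant state unique and the trace the only fixed functional of `Λ`, up
to scalars (`fixed_eq_smul`, `fixed_functional_eq_smul_trace`). The inverse function theorem then
yields an analytic eigenvalue `ev z` of `Λ_z` near `0`, with eigenfunctional `l z` tending to the
trace (`exists_eigenfunctional_branch`). Hence `Tr Λ_z^n ρ = ev(z)^n l_z(ρ) + (Tr - l_z)(Λ_z^n ρ)`.
For imaginary `z` the matrices `Λ_z^n ρ` stay bounded, so the last term vanishes in the limit. No
spectral gap is needed, and `Λ` may be periodic.

For real `θ` near `0`, `ev θ` is real and its modulus is the spectral radius, so `φ = log ev` there.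
Expanding `log ev` to second order gives the limit `exp (-φ''(0) t² / 2)`. Lévy's continuity theorem
gives the Gaussian limit, and tightness gives convergence in probability. -/

namespace QuantumHMM

open Filter Topology

/-! ### Perturbation of a simple eigenvalue -/

section Perturbation

variable {E : Type*} [NormedAddCommGroup E] [NormedSpace ℂ E] [FiniteDimensional ℂ E]

/-- If every fixed functional of `A 0` is a multiple of `τ`, then the eigenvalue `1` of the
transpose of `A 0` extends to a smooth branch of eigenvalues and eigenfunctionals of `A z` for `z`
near `0`, and this branch is locally unique. -/
theorem exists_eigenfunctional_branch {n : WithTop ℕ∞} (hn : n ≠ 0) {A : ℂ → E →L[ℂ] E}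
    (hA : ContDiffAt ℂ n A 0) {τ : E →L[ℂ] ℂ} {σ : E} (hτ : τ ∘L A 0 = τ) (hσ : A 0 σ = σ)
    (hτσ : τ σ = 1) (hfix : ∀ l : E →L[ℂ] ℂ, l ∘L A 0 = l → l = l σ • τ) :
    ∃ (ev : ℂ → ℂ) (l : ℂ → E →L[ℂ] ℂ), ContDiffAt ℂ n ev 0 ∧ ContinuousAt l 0 ∧ ev 0 = 1 ∧
      l 0 = τ ∧ (∀ᶠ z in 𝓝 0, l z ∘L A z = ev z • l z ∧ l z σ = 1) ∧
      ∀ᶠ p : ℂ × ℂ × (E →L[ℂ] ℂ) in 𝓝 (0, 1, τ),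
        p.2.2 ∘L A p.1 = p.2.1 • p.2.2 → p.2.2 σ = 1 → p.2.1 = ev p.1 := by
  -- Normalised eigenpairs `(v, l)` of the transpose of `A z` are the solutions of `F (z, v, l) =
  -- (z, 1, 0)`. Keeping `z` as a coordinate lets the inverse function theorem act as an implicit
  -- one.
  let F : ℂ × ℂ × (E →L[ℂ] ℂ) → ℂ × ℂ × (E →L[ℂ] ℂ) := fun p => (p.1, p.2.2 σ, p.2.2 ∘L A p.1 - p.2.1 • p.2.2)
  let p₀ : ℂ × ℂ × (E →L[ℂ] ℂ) := (0, 1, τ)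
  have hA' : ContDiffAt ℂ n (fun p : ℂ × ℂ × (E →L[ℂ] ℂ) => A p.1) p₀ := hA.comp p₀ contDiffAt_fst
  have hF : ContDiffAt ℂ n F p₀ := by
    refine contDiffAt_fst.prodMk (ContDiffAt.prodMk ?_ (ContDiffAt.sub ?_ ?_))
    · exact (contDiffAt_snd.snd).clm_apply contDiffAt_const
    · exact (contDiffAt_snd.snd).clm_comp hA'
    · exact (contDiffAt_snd.fst).smul contDiffAt_snd.snd
  have hdA : HasFDerivAt A (fderiv ℂ A 0) 0 := (hA.differentiableAt hn).hasFDerivAt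
  have h1 : HasFDerivAt (fun p : ℂ × ℂ × (E →L[ℂ] ℂ) => p.1) (ContinuousLinearMap.fst ℂ ℂ _) p₀ := hasFDerivAt_fst
  have h2 : HasFDerivAt (fun p : ℂ × ℂ × (E →L[ℂ] ℂ) => p.2.1)
      (ContinuousLinearMap.fst ℂ ℂ (E →L[ℂ] ℂ) ∘L ContinuousLinearMap.snd ℂ ℂ _) p₀ :=
    (ContinuousLinearMap.fst ℂ ℂ (E →L[ℂ] ℂ) ∘L ContinuousLinearMap.snd ℂ ℂ _).hasFDerivAt
  have h3 : HasFDerivAt (fun p : ℂ × ℂ × (E →L[ℂ] ℂ) => p.2.2)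
      (ContinuousLinearMap.snd ℂ ℂ (E →L[ℂ] ℂ) ∘L ContinuousLinearMap.snd ℂ ℂ _) p₀ :=
    (ContinuousLinearMap.snd ℂ ℂ (E →L[ℂ] ℂ) ∘L ContinuousLinearMap.snd ℂ ℂ _).hasFDerivAt
  have hdA' : HasFDerivAt (fun p : ℂ × ℂ × (E →L[ℂ] ℂ) => A p.1) (fderiv ℂ A 0 ∘L ContinuousLinearMap.fst ℂ ℂ _) p₀ :=
    HasFDerivAt.comp p₀ (g := A) hdA h1
  have hdF := h1.prodMk ((h3.clm_apply (hasFDerivAt_const σ p₀)).prodMk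
    ((h3.clm_comp hdA').sub (h2.smul h3)))
  -- A kernel vector has `dz = 0`, `dl σ = 0` and `dl ∘ A 0 - dl = dv • τ`. Evaluation at the fixed
  -- vector `σ` kills `dv`, and then `hfix` kills `dl`. In finite dimension injectivity gives
  -- invertibility.
  obtain ⟨F', hF', hinj⟩ : ∃ F' : (ℂ × ℂ × (E →L[ℂ] ℂ)) →L[ℂ] ℂ × ℂ × (E →L[ℂ] ℂ), HasFDerivAt F F' p₀ ∧ Function.Injective F' := by
    refine ⟨_, hdF, (injective_iff_map_eq_zero _).2 ?_⟩
    rintro ⟨dz, dv, dl⟩ h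
    have hz : dz = 0 := congrArg Prod.fst h
    subst hz
    have hl : dl σ = 0 := by
      simpa using congrArg (fun p : ℂ × ℂ × (E →L[ℂ] ℂ) => p.2.1) h
    have hv : dl ∘L A 0 - (dl + dv • τ) = 0 := by
      simpa [p₀] using congrArg (fun p : ℂ × ℂ × (E →L[ℂ] ℂ) => p.2.2) h
    have hdv : dv = 0 := by
      have := congrArg (fun m : E →L[ℂ] ℂ => m σ) hv
      simpa [hσ, hτσ] using this
    subst hdv
    have hdl : dl ∘L A 0 = dl := by
      ext v
      simpa [sub_eq_zero] using congrArg (fun m : E →L[ℂ] ℂ => m v) hv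
    have : dl = 0 := by
      rw [hfix dl hdl, hl]
      ext v
      simp
    simp [this]
  let e : (ℂ × ℂ × (E →L[ℂ] ℂ)) ≃L[ℂ] ℂ × ℂ × (E →L[ℂ] ℂ) := (LinearEquiv.ofInjectiveEndo F'.toLinearMap hinj).toContinuousLinearEquiv
  have he : HasFDerivAt F (e : (ℂ × ℂ × (E →L[ℂ] ℂ)) →L[ℂ] ℂ × ℂ × (E →L[ℂ] ℂ)) p₀ := by
    have : (e : (ℂ × ℂ × (E →L[ℂ] ℂ)) →L[ℂ] ℂ × ℂ × (E →L[ℂ] ℂ)) = F' :=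
      ContinuousLinearMap.ext fun p => rfl
    rwa [this]
  have hst := hF.hasStrictFDerivAt' he hn
  have hFp : F p₀ = (0, 1, 0) := by simp [F, p₀, hτ, hτσ]
  let G := hF.localInverse he hn
  have hG : ContDiffAt ℂ n G (0, 1, 0) := hFp ▸ hF.to_localInverse he hn
  have hG0 : G (0, 1, 0) = p₀ := by
    rw [← hFp]; exact hF.localInverse_apply_image he hn
  let ins : ℂ → ℂ × ℂ × (E →L[ℂ] ℂ) := fun z => (z, 1, 0)
  have hins : ContDiffAt ℂ n ins 0 := contDiffAt_id.prodMk contDiffAt_const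
  have hGi : ContDiffAt ℂ n (fun z => G (ins z)) 0 := ContDiffAt.comp (0 : ℂ) (g := G) hG hins
  refine ⟨fun z => (G (ins z)).2.1, fun z => (G (ins z)).2.2, hGi.snd.fst,
    hGi.continuousAt.snd.snd, ?_, ?_, ?_, ?_⟩
  · simp [ins, hG0, p₀]
  · simp [ins, hG0, p₀]
  · have hr := hst.eventually_right_inverse
    rw [hFp] at hr
    have := hins.continuousAt.eventually hr
    filter_upwards [this] with z hz
    replace hz : F (G (ins z)) = ins z := hz
    have e1 : (G (ins z)).1 = z := congrArg Prod.fst hz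
    have e2 := congrArg (fun p : ℂ × ℂ × (E →L[ℂ] ℂ) => p.2.2) hz
    simp only [F, ins] at e2
    rw [sub_eq_zero] at e2
    simp only [ins] at e1
    rw [e1] at e2
    exact ⟨e2, congrArg (fun p : ℂ × ℂ × (E →L[ℂ] ℂ) => p.2.1) hz⟩
  · filter_upwards [hst.eventually_left_inverse] with p hp h1 h2
    have : F p = ins p.1 := by simp [F, ins, h1, h2]
    have hp' : G (F p) = p := hp
    rw [← this, hp']

end Perturbation

end QuantumHMM

namespace QuantumHMM

open Filter Topology Matrix

attribute [local instance] Matrix.normedAddCommGroup Matrix.normedSpace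

/-! ### Positive trace-preserving maps: invariant states and fixed functionals -/

section Positive

variable {ι : Type*} [Fintype ι]

section
open scoped MatrixOrder Matrix.Norms.L2Operator

lemma span_posSemidef : Submodule.span ℂ {M : Matrix ι ι ℂ | M.PosSemidef} = ⊤ := by
  classical
  have h := CStarAlgebra.span_nonneg (A := Matrix ι ι ℂ)
  simpa only [Matrix.nonneg_iff_posSemidef] using h

lemma exists_eq_conjTranspose_mul_self {M : Matrix ι ι ℂ} (hM : M.PosSemidef) :
    ∃ B : Matrix ι ι ℂ, M = Bᴴ * B := by
  classical
  have h := (CStarAlgebra.nonneg_iff_eq_star_mul_self (a := M)).1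
    (Matrix.nonneg_iff_posSemidef.2 hM)
  exact h

end

/-- With `M = Bᴴ B`, an entry of `M` is an inner product of two columns of `B`, at most the mean of
their squared lengths, and each squared length is at most the trace. The norm is the entrywise
maximum. -/
lemma norm_le_trace {M : Matrix ι ι ℂ} (hM : M.PosSemidef) : ‖M‖ ≤ M.trace.re := by
  obtain ⟨B, rfl⟩ := exists_eq_conjTranspose_mul_self hM
  have ht : (Bᴴ * B).trace.re = ∑ j, ∑ k, ‖B k j‖ ^ 2 := by
    simp only [Matrix.trace, Matrix.diag, Matrix.mul_apply, Matrix.conjTranspose_apply,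
      Complex.re_sum, RCLike.star_def]
    refine Finset.sum_congr rfl fun j _ => Finset.sum_congr rfl fun k _ => ?_
    rw [mul_comm, Complex.mul_conj, Complex.ofReal_re, Complex.normSq_eq_norm_sq]
  have hcol : ∀ j, ∑ k, ‖B k j‖ ^ 2 ≤ (Bᴴ * B).trace.re := fun j => by
    rw [ht]
    exact Finset.single_le_sum (f := fun j => ∑ k, ‖B k j‖ ^ 2)
      (fun _ _ => Finset.sum_nonneg fun _ _ => by positivity) (Finset.mem_univ j)
  have h0 : 0 ≤ (Bᴴ * B).trace.re := by rw [ht]; positivity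
  refine (Matrix.norm_le_iff h0).2 fun i j => ?_
  calc ‖(Bᴴ * B) i j‖ ≤ ∑ k, ‖B k i‖ * ‖B k j‖ := by
        simp only [Matrix.mul_apply, Matrix.conjTranspose_apply]
        refine (norm_sum_le _ _).trans_eq ?_
        simp
    _ ≤ ∑ k, (‖B k i‖ ^ 2 + ‖B k j‖ ^ 2) / 2 :=
        Finset.sum_le_sum fun k _ => by nlinarith [sq_nonneg (‖B k i‖ - ‖B k j‖)]
    _ = ((∑ k, ‖B k i‖ ^ 2) + ∑ k, ‖B k j‖ ^ 2) / 2 := by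
        rw [← Finset.sum_div, Finset.sum_add_distrib]
    _ ≤ (Bᴴ * B).trace.re := by linarith [hcol i, hcol j]

lemma isClosed_posSemidef : IsClosed {M : Matrix ι ι ℂ | M.PosSemidef} := by
  simp only [Matrix.posSemidef_iff_dotProduct_mulVec, Set.ofPred_and, Set.ofPred_forall]
  refine IsClosed.inter ?_ (isClosed_iInter fun x => ?_)
  · exact isClosed_eq (by fun_prop) continuous_id
  · exact isClosed_le continuous_const (by fun_prop)

variable {Λ : Matrix ι ι ℂ →ₗ[ℂ] Matrix ι ι ℂ}

lemma map_conjTranspose (hpos : ∀ M, M.PosSemidef → (Λ M).PosSemidef) (M : Matrix ι ι ℂ) :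
    Λ Mᴴ = (Λ M)ᴴ := by
  have hM : M ∈ Submodule.span ℂ {M : Matrix ι ι ℂ | M.PosSemidef} := by
    rw [span_posSemidef]; trivial
  induction hM using Submodule.span_induction with
  | mem M hM => rw [hM.isHermitian.eq, (hpos M hM).isHermitian.eq]
  | zero => simp
  | add M N _ _ hM hN => simp [hM, hN]
  | smul c M _ hM => simp [hM]

lemma pow_posSemidef {κ : Type*} {Λ : Matrix κ κ ℂ →ₗ[ℂ] Matrix κ κ ℂ}
    (hpos : ∀ M, M.PosSemidef → (Λ M).PosSemidef) (n : ℕ) {M : Matrix κ κ ℂ} (hM : M.PosSemidef) : ((Λ ^ n) M).PosSemidef := by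
  induction n with
  | zero => simpa
  | succ n ih => rw [pow_succ']; exact hpos _ ih

lemma pow_trace (htr : ∀ M, (Λ M).trace = M.trace) (n : ℕ) (M : Matrix ι ι ℂ) :
    ((Λ ^ n) M).trace = M.trace := by
  induction n with
  | zero => simp
  | succ n ih => rw [pow_succ', Module.End.mul_apply, htr, ih]

/-- A positive trace-preserving map has an invariant state. -/
theorem exists_invariant_state (hpos : ∀ M, M.PosSemidef → (Λ M).PosSemidef)
    (htr : ∀ M, (Λ M).trace = M.trace) (ρ : DensityMatrix ι) :
    ∃ σ : DensityMatrix ι, Λ σ.mat = σ.mat := by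
  let K : Set (Matrix ι ι ℂ) := {M | M.PosSemidef} ∩ {M | M.trace = 1}
  have hnorm : ∀ M ∈ K, ‖M‖ ≤ 1 := fun M hM => by
    simpa [hM.2.out] using norm_le_trace hM.1
  have hK : IsCompact K := by
    refine Metric.isCompact_of_isClosed_isBounded ?_ ?_
    · exact isClosed_posSemidef.inter (isClosed_eq (by fun_prop) continuous_const)
    · exact isBounded_iff_forall_norm_le.2 ⟨1, hnorm⟩
  have hit : ∀ k, (Λ ^ k) ρ.mat ∈ K := fun k =>
    ⟨pow_posSemidef hpos k ρ.posSemidef, (pow_trace htr k _).trans ρ.trace_eq_one⟩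
  -- Cesàro means: `Λ (u n) - u n` telescopes to `(Λ^(n+1) ρ - ρ) / (n + 1)`, so every cluster point
  -- is invariant.
  let u : ℕ → Matrix ι ι ℂ := fun n =>
    ((n + 1 : ℝ)⁻¹ : ℂ) • ∑ k ∈ Finset.range (n + 1), (Λ ^ k) ρ.mat
  have hu : ∀ n, u n ∈ K := fun n => by
    constructor
    · refine Matrix.PosSemidef.smul ?_ ?_
      · exact Matrix.posSemidef_sum _ fun k _ => (hit k).1
      · rw [← Complex.ofReal_inv]
        exact Complex.zero_le_real.2 (by positivity)
    · have : ((n : ℂ) + 1) ≠ 0 := Nat.cast_add_one_ne_zero n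
      simp [u, Matrix.trace_sum, (hit _).2.out, this]
  have : FirstCountableTopology (Matrix ι ι ℂ) :=
    inferInstanceAs (FirstCountableTopology (ι → ι → ℂ))
  obtain ⟨σ, hσ, φ, hφ, hlim⟩ := hK.tendsto_subseq hu
  refine ⟨⟨σ, hσ.1, hσ.2⟩, ?_⟩
  have hdiff : ∀ n, ‖Λ (u n) - u n‖ ≤ 2 * (1 / ((n : ℝ) + 1)) := fun n => by
    have : Λ (u n) - u n = ((n + 1 : ℝ)⁻¹ : ℂ) • ((Λ ^ (n + 1)) ρ.mat - ρ.mat) := by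
      simp only [u, map_smul, map_sum, ← smul_sub, ← Finset.sum_sub_distrib]
      congr 1
      have := Finset.sum_range_sub (fun k => (Λ ^ k) ρ.mat) (n + 1)
      simpa [pow_succ'] using this
    rw [this, norm_smul]
    have h2 : ‖(Λ ^ (n + 1)) ρ.mat - ρ.mat‖ ≤ 2 :=
      (norm_sub_le _ _).trans (by
        have h0 : ‖ρ.mat‖ ≤ 1 := hnorm _ (hit 0)
        linarith [hnorm _ (hit (n + 1))])
    have h1 : ‖((n + 1 : ℝ)⁻¹ : ℂ)‖ = 1 / ((n : ℝ) + 1) := by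
      rw [← Complex.ofReal_inv, Complex.norm_real, Real.norm_of_nonneg (by positivity), one_div]
    rw [h1, mul_comm]
    gcongr
  have hzero : Tendsto (fun n => Λ (u n) - u n) atTop (𝓝 0) :=
    squeeze_zero_norm hdiff (by
      simpa using (tendsto_one_div_add_atTop_nhds_zero_nat (𝕜 := ℝ)).const_mul 2)
  have hcont : Continuous Λ := Λ.continuous_of_finiteDimensional
  have h1 := ((hcont.tendsto σ).comp hlim).sub hlim
  exact sub_eq_zero.1 (tendsto_nhds_unique h1 (hzero.comp hφ.tendsto_atTop))

/-- Subtracting the right multiple of a positive definite matrix from a Hermitian matrix leaves a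
positive semi-definite matrix which is not positive definite. -/
lemma exists_sub_smul_posSemidef_not_posDef [Nonempty ι] {σ Y : Matrix ι ι ℂ} (hσ : σ.PosDef)
    (hY : Y.IsHermitian) :
    ∃ m : ℝ, (Y - (m : ℂ) • σ).PosSemidef ∧ ¬ (Y - (m : ℂ) • σ).PosDef := by
  let q : Matrix ι ι ℂ → (ι → ℂ) → ℝ := fun A v => (star v ⬝ᵥ A *ᵥ v).re
  have hqc : ∀ A, Continuous (q A) := fun A => by
    simp only [q]
    fun_prop
  have hqs : ∀ A (c : ℂ) v, q A (c • v) = ‖c‖ ^ 2 * q A v := fun A c v => by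
    simp only [q, star_smul, Matrix.mulVec_smul, smul_dotProduct, dotProduct_smul, smul_eq_mul]
    rw [← mul_assoc, RCLike.star_def, Complex.mul_conj,
      Complex.re_ofReal_mul, Complex.normSq_eq_norm_sq]
  have hpos : ∀ v, v ≠ 0 → 0 < q σ v := fun v hv => hσ.re_dotProduct_pos hv
  have hne : (Metric.sphere (0 : ι → ℂ) 1).Nonempty := NormedSpace.sphere_nonempty.2 zero_le_one
  -- `m` is the minimum of the generalised Rayleigh quotient. The form of `Y - m σ` is then
  -- nonnegative and vanishes at the minimiser `v₀`.
  obtain ⟨v₀, hv₀, hmin⟩ := (isCompact_sphere (0 : ι → ℂ) 1).exists_isMinOn hne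
    (f := fun v => q Y v / q σ v) (ContinuousOn.div (hqc Y).continuousOn (hqc σ).continuousOn
      fun v hv => (hpos v (ne_zero_of_mem_unit_sphere ⟨v, hv⟩)).ne')
  have hv₀' : v₀ ≠ 0 := ne_zero_of_mem_unit_sphere ⟨v₀, hv₀⟩
  set m : ℝ := q Y v₀ / q σ v₀ with hm
  have hherm : (Y - (m : ℂ) • σ).IsHermitian := by
    refine hY.sub ?_
    rw [Matrix.IsHermitian, Matrix.conjTranspose_smul, hσ.isHermitian.eq, RCLike.star_def,
      Complex.conj_ofReal]
  have hq : ∀ v, q (Y - (m : ℂ) • σ) v = q Y v - m * q σ v := fun v => by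
    simp only [q, Matrix.sub_mulVec, Matrix.smul_mulVec, dotProduct_sub, dotProduct_smul,
      smul_eq_mul, Complex.sub_re, Complex.re_ofReal_mul]
  refine ⟨m, Matrix.posSemidef_iff_dotProduct_mulVec.2 ⟨hherm, fun v => ?_⟩, fun h => ?_⟩
  · have him : (star v ⬝ᵥ (Y - (m : ℂ) • σ) *ᵥ v).im = 0 := hherm.im_star_dotProduct_mulVec_self v
    refine Complex.nonneg_iff.2 ⟨?_, him.symm⟩
    change 0 ≤ q (Y - (m : ℂ) • σ) v
    rw [hq]
    rcases eq_or_ne v 0 with rfl | hv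
    · simp [q]
    · have hn : ‖v‖ ≠ 0 := norm_ne_zero_iff.2 hv
      set c : ℂ := ((‖v‖⁻¹ : ℝ) : ℂ)
      have hc : ‖c‖ = ‖v‖⁻¹ := by simp [c]
      have hmem : c • v ∈ Metric.sphere (0 : ι → ℂ) 1 := by
        simp [norm_smul, hc, hn]
      have h := hmin hmem
      simp only [Set.mem_ofPred_eq, hqs] at h
      rw [mul_div_mul_left _ _ (by rw [hc]; positivity), ← hm, le_div_iff₀ (hpos v hv)] at h
      linarith
  · have := h.re_dotProduct_pos hv₀'
    change 0 < q (Y - (m : ℂ) • σ) v₀ at this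
    rw [hq, hm, div_mul_cancel₀ _ (hpos v₀ hv₀').ne', sub_self] at this
    exact this.false

/-- The fixed points of an irreducible positive trace-preserving map are the multiples of its
invariant state. -/
theorem fixed_eq_smul (hpos : ∀ M, M.PosSemidef → (Λ M).PosSemidef)
    (hirr : IsIrreducible Λ) {σ : DensityMatrix ι}
    (hσ : Λ σ.mat = σ.mat) {M : Matrix ι ι ℂ} (hM : Λ M = M) : M = M.trace • σ.mat := by
  have hne : Nonempty ι := by
    by_contra h
    rw [not_nonempty_iff] at h
    simpa [Matrix.trace] using σ.trace_eq_one
  have hdef : ∀ τ : DensityMatrix ι, Λ τ.mat = τ.mat → τ.mat.PosDef := fun τ hτ =>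
    hirr τ 1 zero_le_one (by simp [hτ, Matrix.PosSemidef.zero])
  have hherm : ∀ Y : Matrix ι ι ℂ, Y.IsHermitian → Λ Y = Y → Y = Y.trace • σ.mat := by
    intro Y hY hYfix
    obtain ⟨m, hpsd, hnot⟩ := exists_sub_smul_posSemidef_not_posDef (hdef σ hσ) hY
    set Z := Y - (m : ℂ) • σ.mat with hZ
    have hZfix : Λ Z = Z := by simp [hZ, hYfix, hσ]
    -- Otherwise `Z` normalised is an invariant state, positive definite by irreducibility with `α =
    -- 1`, against the choice of `m`.
    have hZ0 : Z = 0 := by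
      by_contra hZ0
      have htZ : Z.trace ≠ 0 := fun h => hZ0 (hpsd.trace_eq_zero_iff.1 h)
      let τ : DensityMatrix ι := ⟨Z.trace⁻¹ • Z, hpsd.smul (inv_nonneg.2 hpsd.trace_nonneg), by
        simp [htZ]⟩
      have hτ := hdef τ (by simp [τ, hZfix])
      apply hnot
      have := hτ.smul (lt_of_le_of_ne hpsd.trace_nonneg htZ.symm)
      simpa [τ, smul_smul, htZ] using this
    have hYm : Y = (m : ℂ) • σ.mat := sub_eq_zero.1 hZ0
    rw [hYm]
    simp [σ.trace_eq_one]
  -- The general case follows from the Hermitian matrices `M + Mᴴ` and `i (M - Mᴴ)`, both fixed by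
  -- `Λ`.
  have hMH : Λ Mᴴ = Mᴴ := by rw [map_conjTranspose hpos, hM]
  have h1 := hherm (M + Mᴴ) (Matrix.isHermitian_add_transpose_self M) (by simp [hM, hMH])
  have h2 := hherm (Complex.I • (M - Mᴴ))
    (by simp [Matrix.IsHermitian, Matrix.conjTranspose_smul, ← smul_neg])
    (by simp [hM, hMH])
  have h3 : M - Mᴴ = (M - Mᴴ).trace • σ.mat := by
    rw [Matrix.trace_smul, smul_assoc] at h2
    exact smul_right_injective _ Complex.I_ne_zero h2
  have h4 : (2 : ℂ) • M = (2 : ℂ) • (M.trace • σ.mat) := by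
    calc (2 : ℂ) • M = (M + Mᴴ) + (M - Mᴴ) := by rw [two_smul]; abel
      _ = (M + Mᴴ).trace • σ.mat + (M - Mᴴ).trace • σ.mat := by rw [← h1, ← h3]
      _ = _ := by rw [← add_smul, smul_smul, Matrix.trace_add, Matrix.trace_sub]; congr 1; ring
  exact smul_right_injective _ two_ne_zero h4

/-- The fixed functionals of an irreducible positive trace-preserving map are the multiples of the
trace. -/
theorem fixed_functional_eq_smul_trace (hpos : ∀ M, M.PosSemidef → (Λ M).PosSemidef)
    (htr : ∀ M, (Λ M).trace = M.trace) (hirr : IsIrreducible Λ) {σ : DensityMatrix ι}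
    (hσ : Λ σ.mat = σ.mat) {l : Matrix ι ι ℂ →ₗ[ℂ] ℂ} (hl : ∀ M, l (Λ M) = l M)
    (M : Matrix ι ι ℂ) : l M = l σ.mat * M.trace := by
  let T : Matrix ι ι ℂ →ₗ[ℂ] ℂ := Matrix.traceLinearMap ι ℂ ℂ
  let D : Matrix ι ι ℂ →ₗ[ℂ] Matrix ι ι ℂ := Λ - LinearMap.id
  have hker : LinearMap.ker D ≤ Submodule.span ℂ {σ.mat} := fun N hN => by
    have : Λ N = N := by simpa [D, sub_eq_zero] using hN
    rw [fixed_eq_smul hpos hirr hσ this]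
    exact Submodule.smul_mem _ _ (Submodule.mem_span_singleton_self _)
  have hrange : LinearMap.range D ≤ LinearMap.ker T := by
    rintro _ ⟨N, rfl⟩
    simp [D, T, htr]
  have hTsurj : LinearMap.range T = ⊤ := LinearMap.range_eq_top.2 fun c =>
    ⟨c • σ.mat, by simp [T, σ.trace_eq_one]⟩
  have h1 := D.finrank_range_add_finrank_ker
  have h2 := T.finrank_range_add_finrank_ker
  rw [hTsurj, finrank_top, Module.finrank_self] at h2
  have h3 : Module.finrank ℂ (LinearMap.ker D) ≤ 1 :=
    (Submodule.finrank_mono hker).trans (by simpa using finrank_span_le_card ({σ.mat} : Set _))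
  -- The kernel of `Λ - 1` is at most a line and the kernel of the trace is a hyperplane, so
  -- rank-nullity turns the inclusion into an equality. A fixed functional kills this range.
  have heq : LinearMap.range D = LinearMap.ker T :=
    Submodule.eq_of_le_of_finrank_le hrange (by omega)
  have hmem : M - M.trace • σ.mat ∈ LinearMap.range D := by
    rw [heq]
    simp [T, σ.trace_eq_one]
  obtain ⟨N, hN⟩ := hmem
  have h := congrArg l hN
  simp only [D, LinearMap.sub_apply, LinearMap.id_apply, map_sub, hl, sub_self, map_smul,
    smul_eq_mul] at h
  linear_combination -h

end Positive

end QuantumHMM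

namespace QuantumHMM

open Filter Topology Matrix

attribute [local instance] Matrix.normedAddCommGroup Matrix.normedSpace
attribute [-instance] instTopologicalSpaceMatrix Matrix.instUniformSpace

/-! ### Spectral radius from an eigenfunctional near the trace -/

section SpectralRadius

variable {ι : Type*} [Fintype ι] {Λ : Matrix ι ι ℂ →ₗ[ℂ] Matrix ι ι ℂ}

lemma functional_pow {κ : Type*} {Λ : Matrix κ κ ℂ →ₗ[ℂ] Matrix κ κ ℂ}
    {l : Matrix κ κ ℂ →ₗ[ℂ] ℂ} {k : ℂ} (hl : ∀ M, l (Λ M) = k * l M) (n : ℕ)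
    (M : Matrix κ κ ℂ) : l ((Λ ^ n) M) = k ^ n * l M := by
  induction n with
  | zero => simp
  | succ n ih => rw [pow_succ', Module.End.mul_apply, hl, ih, pow_succ', mul_assoc]

/-- On the positive cone `hnear` gives `Tr ≤ 2 |l|`, the trace dominates the norm, and `l` is
multiplied by `k` at each step. Positive matrices span, so the bound extends to all `M`, with a
constant depending on `M`. -/
lemma exists_norm_pow_le (hpos : ∀ M, M.PosSemidef → (Λ M).PosSemidef)
    {l : Matrix ι ι ℂ →ₗ[ℂ] ℂ} {k : ℂ} (hl : ∀ M, l (Λ M) = k * l M)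
    (hnear : ∀ M : Matrix ι ι ℂ, M.PosSemidef → ‖l M - M.trace‖ ≤ 1 / 2 * M.trace.re)
    (M : Matrix ι ι ℂ) : ∃ c : ℝ, ∀ n : ℕ, ‖(Λ ^ n) M‖ ≤ c * ‖k‖ ^ n := by
  have hM : M ∈ Submodule.span ℂ {M : Matrix ι ι ℂ | M.PosSemidef} := by
    rw [span_posSemidef]; trivial
  induction hM using Submodule.span_induction with
  | mem M hM =>
    refine ⟨2 * ‖l M‖, fun n => ?_⟩
    have hn := pow_posSemidef hpos n hM
    have h1 := norm_le_trace hn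
    have h2 := hnear _ hn
    have h3 : ((Λ ^ n) M).trace.re ≤ ‖l ((Λ ^ n) M)‖ + 1 / 2 * ((Λ ^ n) M).trace.re :=
      calc ((Λ ^ n) M).trace.re ≤ ‖((Λ ^ n) M).trace‖ := Complex.re_le_norm _
        _ = ‖l ((Λ ^ n) M) - (l ((Λ ^ n) M) - ((Λ ^ n) M).trace)‖ := by rw [sub_sub_cancel]
        _ ≤ _ := (norm_sub_le _ _).trans (by gcongr)
    rw [functional_pow hl, norm_mul, norm_pow] at h3
    linarith
  | zero => exact ⟨0, by simp⟩
  | add M N _ _ hM hN =>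
    obtain ⟨c, hc⟩ := hM
    obtain ⟨d, hd⟩ := hN
    refine ⟨c + d, fun n => ?_⟩
    rw [map_add, add_mul]
    exact (norm_add_le _ _).trans (add_le_add (hc n) (hd n))
  | smul a M _ hM =>
    obtain ⟨c, hc⟩ := hM
    refine ⟨‖a‖ * c, fun n => ?_⟩
    rw [map_smul, norm_smul, mul_assoc]
    exact mul_le_mul_of_nonneg_left (hc n) (norm_nonneg _)

/-- A positive map having an eigenfunctional which is close to the trace has the modulus of the
corresponding eigenvalue as its spectral radius. -/
theorem spectralRadius_eq_of_functional (hpos : ∀ M, M.PosSemidef → (Λ M).PosSemidef)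
    {l : Matrix ι ι ℂ →ₗ[ℂ] ℂ} {k : ℂ} (hk : k ≠ 0) (hl0 : l ≠ 0)
    (hl : ∀ M, l (Λ M) = k * l M)
    (hnear : ∀ M : Matrix ι ι ℂ, M.PosSemidef → ‖l M - M.trace‖ ≤ 1 / 2 * M.trace.re) :
    spectralRadius ℂ (Λ : Module.End ℂ (Matrix ι ι ℂ)) = ‖k‖₊ := by
  refine le_antisymm (iSup₂_le fun μ hμ => ?_) ?_
  · obtain ⟨M, hM⟩ := (Module.End.hasEigenvalue_iff_mem_spectrum.2 hμ).exists_hasEigenvector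
    obtain ⟨c, hc⟩ := exists_norm_pow_le hpos hl hnear M
    have hM0 : 0 < ‖M‖ := norm_pos_iff.2 hM.2
    have hk0 : 0 < ‖k‖ := norm_pos_iff.2 hk
    rw [ENNReal.coe_le_coe, ← NNReal.coe_le_coe, coe_nnnorm, coe_nnnorm]
    by_contra! hlt
    have hbig := tendsto_pow_atTop_atTop_of_one_lt ((one_lt_div hk0).2 hlt)
    obtain ⟨n, hn⟩ := (hbig.eventually_gt_atTop (c / ‖M‖)).exists
    have h := hc n
    rw [hM.pow_apply, norm_smul, norm_pow] at h
    rw [div_pow, div_lt_div_iff₀ hM0 (by positivity)] at hn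
    linarith
  -- `k` lies in the spectrum: `l` vanishes on the range of `k - Λ`, so surjectivity of that map
  -- would force `l = 0`.
  · refine le_iSup₂_of_le (f := fun (μ : ℂ) (_ : μ ∈ spectrum ℂ _) => (‖μ‖₊ : ENNReal)) k ?_ le_rfl
    rw [spectrum.mem_iff]
    intro hu
    have hbij := (Module.End.isUnit_iff _).1 hu
    apply hl0
    ext1 N
    obtain ⟨M, rfl⟩ := hbij.2 N
    simp [Module.algebraMap_end_apply, hl]

end SpectralRadius

/-! ### Tilted maps and their leading eigenvalue -/

namespace Instrument

variable {ι Ω : Type*} [Fintype ι] [Fintype Ω] (C : Instrument Ω ι) (x : Ω → ℝ)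

/-- The tilted map `∑ ω, exp (z x_ω) C_ω` for a complex parameter `z`. -/
noncomputable def complexTilted (z : ℂ) : Matrix ι ι ℂ →ₗ[ℂ] Matrix ι ι ℂ :=
  ∑ ω, Complex.exp (z * x ω) • C.map ω

lemma tilted_eq_complexTilted (θ : ℝ) : C.tilted x θ = C.complexTilted x θ := by
  simp [tilted, complexTilted]

lemma complexTilted_zero : C.complexTilted x 0 = C.total := by
  simp [total, complexTilted]

lemma total_posSemidef {M : Matrix ι ι ℂ} (hM : M.PosSemidef) : (C.total M).PosSemidef := by
  rw [total, LinearMap.sum_apply]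
  exact Matrix.posSemidef_sum _ fun ω _ => C.map_posSemidef ω hM

lemma complexTilted_posSemidef (θ : ℝ) {M : Matrix ι ι ℂ} (hM : M.PosSemidef) :
    (C.complexTilted x θ M).PosSemidef := by
  rw [complexTilted, LinearMap.sum_apply]
  refine Matrix.posSemidef_sum _ fun ω _ => ?_
  rw [LinearMap.smul_apply]
  refine (C.map_posSemidef ω hM).smul ?_
  rw [← Complex.ofReal_mul, ← Complex.ofReal_exp]
  exact Complex.zero_le_real.2 (Real.exp_pos _).le

/-- The power expands over words of outcomes. For a state `M`, the trace of this identity expresses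
the moment generating function of `∑ X_i` through `Λ_z^n`. -/
lemma sum_exp_smul_evolve (z : ℂ) (n : ℕ) (M : Matrix ι ι ℂ) :
    ∑ w : Fin n → Ω, Complex.exp (z * ∑ i, (x (w i) : ℂ)) • C.evolve n w M
      = (C.complexTilted x z ^ n) M := by
  induction n with
  | zero => simp [evolve]
  | succ n ih =>
    rw [← (Fin.snocEquiv fun _ : Fin (n + 1) => Ω).sum_comp, Fintype.sum_prod_type_right,
      pow_succ', Module.End.mul_apply, ← ih, map_sum]
    refine Finset.sum_congr rfl fun w _ => ?_
    simp only [map_smul, complexTilted, LinearMap.sum_apply, LinearMap.smul_apply, Finset.smul_sum]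
    refine Finset.sum_congr rfl fun ω _ => ?_
    simp [evolve, Fin.snocEquiv, Fin.sum_univ_castSucc, mul_add, Complex.exp_add, smul_smul]

/-- For imaginary `z` the weights have modulus one, so the triangle inequality over words bounds the
norm by the total probability. -/
lemma norm_pow_complexTilted_le {z : ℂ} (hz : z.re = 0) (n : ℕ) (ρ : DensityMatrix ι) :
    ‖(C.complexTilted x z ^ n) ρ.mat‖ ≤ 1 := by
  rw [← C.sum_exp_smul_evolve]
  calc _ ≤ ∑ w : Fin n → Ω, ‖Complex.exp (z * ∑ i, (x (w i) : ℂ)) • C.evolve n w ρ.mat‖ :=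
        norm_sum_le _ _
    _ ≤ ∑ w : Fin n → Ω, (C.evolve n w ρ.mat).trace.re := Finset.sum_le_sum fun w _ => by
        have : ‖Complex.exp (z * ∑ i, (x (w i) : ℂ))‖ = 1 := by
          rw [Complex.norm_exp, ← Complex.ofReal_sum, Complex.re_mul_ofReal, hz]
          simp
        rw [norm_smul, this, one_mul]
        exact norm_le_trace (C.evolve_posSemidef n w ρ.posSemidef)
    _ = 1 := by rw [← Complex.re_sum, C.sum_trace_evolve, ρ.trace_eq_one, Complex.one_re]

/-- The functional `M ↦ conj (l Mᴴ)`. -/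
noncomputable def conjFunctional (l : Matrix ι ι ℂ →L[ℂ] ℂ) : Matrix ι ι ℂ →L[ℂ] ℂ :=
  LinearMap.toContinuousLinearMap
    { toFun := fun M => starRingEnd ℂ (l Mᴴ)
      map_add' := by simp
      map_smul' := by simp }

lemma conjFunctional_apply (l : Matrix ι ι ℂ →L[ℂ] ℂ) (M : Matrix ι ι ℂ) :
    conjFunctional l M = starRingEnd ℂ (l Mᴴ) := rfl

lemma continuous_conjFunctional :
    Continuous (conjFunctional : (Matrix ι ι ℂ →L[ℂ] ℂ) → Matrix ι ι ℂ →L[ℂ] ℂ) := by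
  rw [continuous_clm_apply]
  intro M
  simp only [conjFunctional_apply]
  exact Complex.continuous_conj.comp (ContinuousLinearMap.apply ℂ ℂ Mᴴ).continuous

/-- The Perron-Frobenius eigenvalue of the tilted maps extends to a smooth function of a complex
parameter near `0`, which governs the asymptotics of the powers of the tilted maps. -/
theorem exists_eigenvalue_branch (hC : IsIrreducible C.total) (ρ : DensityMatrix ι) :
    ∃ ev : ℂ → ℂ, AnalyticAt ℂ ev 0 ∧ ev 0 = 1 ∧
      (∀ᶠ θ : ℝ in 𝓝 0, (ev θ).im = 0 ∧ C.pfEigenvalue x θ = ‖ev θ‖) ∧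
      ∀ (z u : ℕ → ℂ) (c : ℂ), Tendsto z atTop (𝓝 0) → (∀ n, (z n).re = 0) → (∀ n, ‖u n‖ ≤ 1) →
        Tendsto (fun n => u n * ev (z n) ^ n) atTop (𝓝 c) →
        Tendsto (fun n => u n * ((C.complexTilted x (z n) ^ n) ρ.mat).trace) atTop (𝓝 c) := by
  have hpos : ∀ M, M.PosSemidef → (C.total M).PosSemidef := fun M => C.total_posSemidef
  have htr : ∀ M, (C.total M).trace = M.trace := C.tracePreserving
  obtain ⟨σ, hσ⟩ := exists_invariant_state hpos htr ρ
  let A : ℂ → Matrix ι ι ℂ →L[ℂ] Matrix ι ι ℂ := fun z =>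
    ∑ i, Complex.exp (z * x i) • LinearMap.toContinuousLinearMap (C.map i)
  have hA : ContDiffAt ℂ ⊤ A 0 := by
    refine ContDiff.contDiffAt (ContDiff.sum fun i _ => ?_)
    have h : ContDiff ℂ ⊤ fun z : ℂ => Complex.exp (z * x i) := by fun_prop
    exact h.smul contDiff_const
  have hAapp : ∀ z M, A z M = C.complexTilted x z M := fun z M => by
    simp [A, complexTilted]
  have hA0 : ∀ M, A 0 M = C.total M := fun M => by rw [hAapp, complexTilted_zero]
  let τ : Matrix ι ι ℂ →L[ℂ] ℂ := LinearMap.toContinuousLinearMap (Matrix.traceLinearMap ι ℂ ℂ)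
  have hτ : ∀ M, τ M = M.trace := fun M => rfl
  obtain ⟨ev, l, hev, hl, hev0, hl0, heig, huniq⟩ :=
    exists_eigenfunctional_branch (n := ⊤) (by simp) hA (τ := τ) (σ := σ.mat)
      (by ext1 M; simp [hτ, hA0, htr]) (by rw [hA0, hσ]) (by rw [hτ, σ.trace_eq_one])
      (fun m hm => by
        ext1 M
        have h := fixed_functional_eq_smul_trace hpos htr hC hσ (l := m.toLinearMap)
          (fun N => by simpa [hA0] using congrArg (fun k : Matrix ι ι ℂ →L[ℂ] ℂ => k N) hm) M
        simpa [hτ] using h)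
  have heig' : ∀ᶠ z in 𝓝 (0 : ℂ), (∀ M, l z (C.complexTilted x z M) = ev z * l z M) ∧
      l z σ.mat = 1 := heig.mono fun z hz => ⟨fun M => by
    simpa [hAapp] using congrArg (fun k : Matrix ι ι ℂ →L[ℂ] ℂ => k M) hz.1, hz.2⟩
  have hre : Tendsto (fun θ : ℝ => (θ : ℂ)) (𝓝 0) (𝓝 0) := by
    simpa using Complex.continuous_ofReal.tendsto 0
  have hlτ : Tendsto l (𝓝 0) (𝓝 τ) := hl0 ▸ hl.tendsto
  have hconjτ : conjFunctional τ = τ := by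
    ext1 M
    simp [conjFunctional_apply, hτ]
  refine ⟨ev, hev.analyticAt, hev0, ?_, ?_⟩
  · have hnear : ∀ᶠ z in 𝓝 (0 : ℂ), ‖l z - τ‖ ≤ 1 / 2 := by
      have := (hlτ.sub_const τ).norm
      rw [sub_self, norm_zero] at this
      exact this.eventually_le_const (by norm_num)
    have hne : ∀ᶠ z in 𝓝 (0 : ℂ), ev z ≠ 0 :=
      hev.continuousAt.eventually_ne (by rw [hev0]; exact one_ne_zero)
    -- For real `θ` the tilted map commutes with the adjoint, so the conjugate of `l θ` is a
    -- normalised eigenfunctional for the conjugate of `ev θ`. Local uniqueness of the branch then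
    -- makes `ev θ` real.
    have hconj : ∀ᶠ θ : ℝ in 𝓝 0,
        (conjFunctional (l θ) ∘L A θ = starRingEnd ℂ (ev θ) • conjFunctional (l θ) →
          conjFunctional (l θ) σ.mat = 1 → starRingEnd ℂ (ev θ) = ev θ) := by
      have h1 : Tendsto (fun θ : ℝ => starRingEnd ℂ (ev θ)) (𝓝 0) (𝓝 1) := by
        have := (Complex.continuous_conj.tendsto _).comp (hev.continuousAt.tendsto.comp hre)
        simpa [hev0, Function.comp_def] using this
      have h2 : Tendsto (fun θ : ℝ => conjFunctional (l θ)) (𝓝 0) (𝓝 τ) := by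
        have := (continuous_conjFunctional.tendsto τ).comp (hlτ.comp hre)
        rwa [hconjτ] at this
      exact (hre.prodMk_nhds (h1.prodMk_nhds h2)).eventually huniq
    filter_upwards [hre.eventually hnear, hre.eventually hne, hconj, hre.eventually heig']
      with θ h1 h2 h3 h4
    constructor
    · refine Complex.conj_eq_iff_im.1 (h3 ?_ ?_)
      · ext1 M
        simp only [ContinuousLinearMap.comp_apply, _root_.smul_apply, hAapp,
          conjFunctional_apply, smul_eq_mul]
        rw [← map_conjTranspose (fun M => C.complexTilted_posSemidef x θ), h4.1, map_mul]
      · rw [conjFunctional_apply, σ.posSemidef.isHermitian.eq, h4.2, map_one]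
    · have := spectralRadius_eq_of_functional (Λ := C.complexTilted x θ)
        (fun M => C.complexTilted_posSemidef x θ) (l := (l θ).toLinearMap) h2
        (fun h => by simpa [h4.2] using congrArg (fun k : Matrix ι ι ℂ →ₗ[ℂ] ℂ => k σ.mat) h) h4.1
        (fun M hM => by
          have h := (l θ - τ).le_opNorm M
          have h' : ‖l θ - τ‖ * ‖M‖ ≤ 1 / 2 * M.trace.re :=
            mul_le_mul h1 (norm_le_trace hM) (norm_nonneg _) (by norm_num)
          exact h.trans h')
      rw [pfEigenvalue, tilted_eq_complexTilted, this]
      simp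
  · intro z u c hz hz0 hu hc
    -- The trace is split as `l (z n)` plus `τ - l (z n)`. The first part evolves by powers of `ev
    -- (z n)`; the second tends to `0` in norm and acts on matrices of norm at most one.
    have h1 : Tendsto (fun n => u n * ev (z n) ^ n * l (z n) ρ.mat) atTop (𝓝 c) := by
      have : Tendsto (fun n => l (z n) ρ.mat) atTop (𝓝 1) := by
        have := (((ContinuousLinearMap.apply ℂ ℂ ρ.mat).continuous.tendsto τ).comp hlτ).comp hz
        simpa [hτ, ρ.trace_eq_one, Function.comp_def] using this
      simpa using hc.mul this
    have h2 : Tendsto (fun n => u n * (τ - l (z n)) ((C.complexTilted x (z n) ^ n) ρ.mat))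
        atTop (𝓝 0) := by
      have hnorm : Tendsto (fun n => ‖τ - l (z n)‖) atTop (𝓝 0) := by
        have := ((hlτ.comp hz).const_sub τ).norm
        simpa [Function.comp_def] using this
      refine squeeze_zero_norm (fun n => ?_) hnorm
      rw [norm_mul]
      refine (mul_le_of_le_one_left (norm_nonneg _) (hu n)).trans ?_
      refine ((τ - l (z n)).le_opNorm _).trans (mul_le_of_le_one_right (norm_nonneg _) ?_)
      exact C.norm_pow_complexTilted_le x (hz0 n) n ρ
    have h3 := h1.add h2
    rw [add_zero] at h3
    refine h3.congr' ?_
    filter_upwards [hz.eventually heig'] with n hn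
    have := functional_pow (l := (l (z n)).toLinearMap) hn.1 n ρ.mat
    simp only [ContinuousLinearMap.coe_coe] at this
    rw [_root_.sub_apply, this, hτ]
    ring

end Instrument

end QuantumHMM

namespace QuantumHMM

open Filter Topology Asymptotics

/-! ### Derivatives along the reals and second-order asymptotics -/

section Analysis

/-- Along the reals `Im f = Re (-i f)` vanishes near `θ`, and its derivative there is `Im f'(θ)`. -/
lemma deriv_im_eq_zero {f : ℂ → ℂ} {θ : ℝ} (hf : DifferentiableAt ℂ f θ)
    (hreal : ∀ᶠ t : ℝ in 𝓝 θ, (f t).im = 0) : (deriv f θ).im = 0 := by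
  have h := (hf.hasDerivAt.const_mul (-Complex.I)).real_of_complex
  have h' : HasDerivAt (fun t : ℝ => (-Complex.I * f t).re) 0 θ :=
    (hasDerivAt_const θ (0 : ℝ)).congr_of_eventuallyEq (by
      filter_upwards [hreal] with t ht
      simp [ht])
  simpa using h.unique h'

lemma eventually_deriv_im_eq_zero {f : ℂ → ℂ} (hf : AnalyticAt ℂ f 0)
    (hreal : ∀ᶠ t : ℝ in 𝓝 0, (f t).im = 0) : ∀ᶠ t : ℝ in 𝓝 0, (deriv f t).im = 0 := by
  have hre : Tendsto (fun θ : ℝ => (θ : ℂ)) (𝓝 0) (𝓝 0) := by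
    simpa using Complex.continuous_ofReal.tendsto 0
  filter_upwards [hre.eventually hf.eventually_analyticAt, hreal.eventually_nhds] with t h1 h2
  exact deriv_im_eq_zero h1.differentiableAt h2

/-- The first two derivatives at `0` of the real part of an analytic function along the reals. -/
lemma contDiffAt_and_deriv_of_eventuallyEq_re {f : ℂ → ℂ} {g : ℝ → ℝ} (hf : AnalyticAt ℂ f 0)
    (hreal : ∀ᶠ t : ℝ in 𝓝 0, (f t).im = 0) (hg : ∀ᶠ t : ℝ in 𝓝 0, g t = (f t).re) :
    ContDiffAt ℝ 2 g 0 ∧ ((deriv g 0 : ℝ) : ℂ) = deriv f 0 ∧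
      ((deriv (deriv g) 0 : ℝ) : ℂ) = deriv (deriv f) 0 := by
  have hre : Tendsto (fun θ : ℝ => (θ : ℂ)) (𝓝 0) (𝓝 0) := by
    simpa using Complex.continuous_ofReal.tendsto 0
  have hkey : ∀ {f : ℂ → ℂ} {g : ℝ → ℝ}, AnalyticAt ℂ f 0 → (∀ᶠ t : ℝ in 𝓝 0, g t = (f t).re) →
      ∀ᶠ t : ℝ in 𝓝 0, deriv g t = (deriv f t).re := by
    intro f g hf hg
    filter_upwards [hre.eventually hf.eventually_analyticAt, hg.eventually_nhds] with t h1 h2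
    exact (h1.differentiableAt.hasDerivAt.real_of_complex.congr_of_eventuallyEq h2).deriv
  have h1 := hkey hf hg
  have h2 := hkey hf.deriv h1
  have i1 := eventually_deriv_im_eq_zero hf hreal
  have i2 := eventually_deriv_im_eq_zero hf.deriv i1
  refine ⟨?_, ?_, ?_⟩
  · have : ContDiffAt ℝ 2 (fun t : ℝ => (f t).re) 0 := by
      have hf' : ContDiffAt ℂ 2 f ((0 : ℝ) : ℂ) := by simpa using hf.contDiffAt
      exact hf'.real_of_complex
    exact this.congr_of_eventuallyEq hg
  · have := h1.self_of_nhds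
    have := i1.self_of_nhds
    apply Complex.ext <;> simp_all
  · have := h2.self_of_nhds
    have := i2.self_of_nhds
    apply Complex.ext <;> simp_all

/-- Second order Taylor expansion of an analytic function. -/
lemma taylor_two_isLittleO {f : ℂ → ℂ} (hf : AnalyticAt ℂ f 0) (hf0 : f 0 = 0) :
    (fun z => f z - deriv f 0 * z - deriv (deriv f) 0 / 2 * z ^ 2) =o[𝓝 0] fun z => z ^ 2 := by
  set a := deriv f 0 with ha
  set b := deriv (deriv f) 0 with hb
  have hd : (fun z => deriv f z - a - b * z) =o[𝓝 0] fun z => z := by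
    have := hf.deriv.differentiableAt.hasDerivAt.isLittleO
    simpa [mul_comm, ← ha, ← hb] using this
  obtain ⟨r, hr, hball⟩ := Metric.eventually_nhds_iff_ball.1 hf.eventually_analyticAt
  have hmem : Metric.ball (0 : ℂ) r ∈ 𝓝 0 := Metric.ball_mem_nhds 0 hr
  -- The Taylor remainder has derivative `f' z - a - b z = o(z)`; the mean value inequality on a
  -- convex ball raises this to `o(z²)`.
  have h := (convex_ball (0 : ℂ) r).isLittleO_pow_succ (n := 1) (𝕜 := ℂ) (Metric.mem_ball_self hr)
    (f := fun z => f z - a * z - b / 2 * z ^ 2)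
    (f' := fun z => ContinuousLinearMap.toSpanSingleton ℂ (deriv f z - a - b * z))
    (fun z hz => by
      have h1 := (hball z hz).differentiableAt.hasDerivAt
      have h2 := (h1.sub ((hasDerivAt_id z).const_mul a)).sub
        (((hasDerivAt_id z).pow 2).const_mul (b / 2))
      have h3 : HasDerivAt (fun z => f z - a * z - b / 2 * z ^ 2) (deriv f z - a - b * z) z := by
        refine h2.congr_deriv ?_
        simp
        ring
      exact h3.hasFDerivAt.hasFDerivWithinAt)
    (by
      rw [nhdsWithin_eq_nhds.2 hmem, ← isLittleO_norm_left]
      simpa using hd.norm_left.norm_right)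
  rw [nhdsWithin_eq_nhds.2 hmem] at h
  rw [← isLittleO_norm_right]
  simpa [hf0] using h

/-- Write `f(z)^n = exp (n log f(z))` at `z = i t / √n`. Since `n z = i t √n`, the prefactor cancels
the linear Taylor term; since `n z² = -t²`, the quadratic term gives the limit and the remainder is
`o(1)`. -/
lemma tendsto_exp_mul_pow {f : ℂ → ℂ} (hf : AnalyticAt ℂ f 0) (hf0 : f 0 = 1) (t : ℝ) :
    Tendsto (fun n : ℕ => Complex.exp (-(t * √n * Complex.I *
        deriv (fun z => Complex.log (f z)) 0)) * f (t * Complex.I / √n) ^ n) atTop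
      (𝓝 (Complex.exp (-(deriv (deriv fun z => Complex.log (f z)) 0 * t ^ 2 / 2)))) := by
  set L : ℂ → ℂ := fun z => Complex.log (f z) with hL
  have hLa : AnalyticAt ℂ L 0 := hf.clog (by simp [hf0])
  have hL0 : L 0 = 0 := by simp [hL, hf0]
  set a := deriv L 0
  set b := deriv (deriv L) 0
  let z : ℕ → ℂ := fun n => t * Complex.I / √n
  have hz : Tendsto z atTop (𝓝 0) := by
    have h1 : Tendsto (fun n : ℕ => ‖(t * Complex.I : ℂ)‖ / √(n : ℝ)) atTop (𝓝 0) :=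
      tendsto_const_nhds.div_atTop
        (Real.tendsto_sqrt_atTop.comp tendsto_natCast_atTop_atTop)
    refine squeeze_zero_norm (fun n => ?_) h1
    simp [z, abs_of_nonneg]
  have hsq : ∀ n : ℕ, 0 < n → (n : ℂ) * z n ^ 2 = -(t ^ 2) := fun n hn => by
    have hn' : (n : ℂ) ≠ 0 := by exact_mod_cast hn.ne'
    have : ((√n : ℝ) : ℂ) ^ 2 = n := by
      rw [← Complex.ofReal_pow, Real.sq_sqrt n.cast_nonneg, Complex.ofReal_natCast]
    simp only [z]
    rw [div_pow, this, mul_pow, Complex.I_sq]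
    field_simp
  have hlin : ∀ n : ℕ, 0 < n → (n : ℂ) * z n = t * √n * Complex.I := fun n hn => by
    have hn' : ((√n : ℝ) : ℂ) ≠ 0 := by
      exact_mod_cast (Real.sqrt_pos.2 (Nat.cast_pos.2 hn)).ne'
    have : ((√n : ℝ) : ℂ) ^ 2 = n := by
      rw [← Complex.ofReal_pow, Real.sq_sqrt n.cast_nonneg, Complex.ofReal_natCast]
    simp only [z]
    rw [← this]
    field_simp
  have hrem : Tendsto (fun n : ℕ => (n : ℂ) * (L (z n) - a * z n - b / 2 * z n ^ 2)) atTop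
      (𝓝 0) := by
    have h1 := (taylor_two_isLittleO hLa hL0).comp_tendsto hz
    have h2 := (isBigO_refl (fun n : ℕ => (n : ℂ)) atTop).mul_isLittleO h1
    have h3 : (fun n : ℕ => (n : ℂ) * z n ^ 2) =O[atTop] fun _ => (1 : ℝ) := by
      refine IsBigO.of_bound (‖(t : ℂ) ^ 2‖) ?_
      filter_upwards [eventually_gt_atTop 0] with n hn
      rw [hsq n hn]
      simp
    exact (isLittleO_one_iff ℝ).1 (h2.trans_isBigO h3)
  have hexp : Tendsto (fun n : ℕ => Complex.exp ((n : ℂ) * (L (z n) - a * z n - b / 2 * z n ^ 2)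
      + -(b * t ^ 2 / 2))) atTop (𝓝 (Complex.exp (-(b * t ^ 2 / 2)))) := by
    have := (hrem.add_const (-(b * t ^ 2 / 2))).cexp
    rwa [zero_add] at this
  refine hexp.congr' ?_
  have hne : ∀ᶠ n in atTop, f (z n) ≠ 0 :=
    hz.eventually (hf.continuousAt.eventually_ne (by rw [hf0]; exact one_ne_zero))
  filter_upwards [hne, eventually_gt_atTop 0] with n hn hn0
  have h1 : f (z n) ^ n = Complex.exp (n * L (z n)) := by
    rw [Complex.exp_nat_mul, Complex.exp_log hn]
  change _ = _ * f (z n) ^ n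
  rw [h1, ← Complex.exp_add, ← hlin n hn0]
  congr 1
  have := hsq n hn0
  linear_combination (-b / 2) * this

end Analysis

end QuantumHMM

namespace QuantumHMM

open Filter Topology MeasureTheory ProbabilityTheory

/-! ### From characteristic functions to convergence in law and tightness -/

section WeakConvergence

variable {S : ℕ → Type*} [∀ n, MeasurableSpace (S n)] {P : ∀ n, Measure (S n)}
  [∀ n, IsProbabilityMeasure (P n)] {Y : ∀ n, S n → ℝ}

lemma tendstoInDistribution_id_of_tendsto_charFun {ν : Measure ℝ} [IsProbabilityMeasure ν]
    (hY : ∀ n, Measurable (Y n))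
    (h : ∀ t, Tendsto (fun n => charFun ((P n).map (Y n)) t) atTop (𝓝 (charFun ν t))) :
    TendstoInDistribution Y atTop (id : ℝ → ℝ) P ν where
  forall_aemeasurable n := (hY n).aemeasurable
  aemeasurable_limit := aemeasurable_id
  tendsto := by
    refine ProbabilityMeasure.tendsto_of_tendsto_charFun fun t => ?_
    simpa using h t

lemma tendsto_measureReal_le_of_tendstoInDistribution {ν : Measure ℝ} [IsProbabilityMeasure ν]
    (hY : ∀ n, Measurable (Y n)) (h : TendstoInDistribution Y atTop (id : ℝ → ℝ) P ν) {δ : ℝ}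
    (hδ : ν {δ} = 0) :
    Tendsto (fun n => (P n).real {w | Y n w ≤ δ}) atTop (𝓝 (ν.real (Set.Iic δ))) := by
  have := ProbabilityMeasure.tendsto_measure_of_null_frontier_of_tendsto' h.tendsto
    (E := Set.Iic δ) (by simpa [frontier_Iic] using hδ)
  simp only [ProbabilityMeasure.coe_mk, Measure.map_id] at this
  have h2 := (ENNReal.tendsto_toReal (measure_ne_top ν _)).comp this
  refine h2.congr fun n => ?_
  simp only [Function.comp_apply, Measure.real]
  rw [Measure.map_apply (hY n) measurableSet_Iic]
  rfl

/-- A pointwise limit of characteristic functions that is continuous at `0` forces tightness, so no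
mass escapes beyond thresholds tending to infinity. -/
lemma tendsto_measureReal_abs_ge_of_tendsto_charFun {f : ℝ → ℂ} (hf : ContinuousAt f 0)
    (hY : ∀ n, Measurable (Y n))
    (h : ∀ t, Tendsto (fun n => charFun ((P n).map (Y n)) t) atTop (𝓝 (f t))) {r : ℕ → ℝ}
    (hr : Tendsto r atTop atTop) :
    Tendsto (fun n => (P n).real {w | r n < |Y n w|}) atTop (𝓝 0) := by
  have hprob : ∀ n, IsProbabilityMeasure ((P n).map (Y n)) := fun n =>
    Measure.isProbabilityMeasure_map (hY n).aemeasurable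
  have ht := isTightMeasureSet_of_tendsto_charFun hf h
  rw [isTightMeasureSet_iff_tendsto_measure_norm_gt] at ht
  have h0 : Tendsto (fun n => P n {w | r n < |Y n w|}) atTop (𝓝 0) := by
    refine tendsto_of_tendsto_of_tendsto_of_le_of_le tendsto_const_nhds (ht.comp hr)
      (fun _ => zero_le) fun n => ?_
    have : P n {w | r n < |Y n w|} = (P n).map (Y n) {y | r n < ‖y‖} := by
      rw [Measure.map_apply (hY n) (measurableSet_lt measurable_const measurable_norm)]
      rfl
    simp only [Function.comp_apply]
    rw [this]
    exact le_iSup₂_of_le (f := fun (μ : Measure ℝ) (_ : μ ∈ Set.range _) => μ {y | r n < ‖y‖})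
      _ (Set.mem_range_self n) le_rfl
  simpa [Measure.real, Function.comp_def] using
    (ENNReal.tendsto_toReal ENNReal.zero_ne_top).comp h0

end WeakConvergence

lemma gaussianReal_real_Iic {v : ℝ} (hv : 0 < v) (δ : ℝ) :
    (gaussianReal 0 v.toNNReal).real (Set.Iic δ) = stdNormalCDF (δ / √v) := by
  have hmap : gaussianReal 0 v.toNNReal = (gaussianReal 0 1).map (√v * ·) := by
    rw [gaussianReal_map_const_mul]
    congr 1
    · simp
    · ext
      simp [Real.sq_sqrt hv.le, hv.le]
  have hpre : (√v * ·) ⁻¹' Set.Iic δ = Set.Iic (δ / √v) := by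
    ext y
    simp [le_div_iff₀' (Real.sqrt_pos.2 hv)]
  rw [hmap, Measure.real, Measure.map_apply (by fun_prop) measurableSet_Iic, hpre,
    gaussianReal_apply_eq_integral _ one_ne_zero, ENNReal.toReal_ofReal
      (integral_nonneg fun _ => gaussianPDFReal_nonneg _ _ _), stdNormalCDF]
  congr 1
  ext t
  simp [gaussianPDFReal, div_eq_inv_mul]

namespace Instrument

variable {ι Ω : Type*} [Fintype ι] [Fintype Ω] [MeasurableSpace Ω] [MeasurableSingletonClass Ω]
  (C : Instrument Ω ι) (x : Ω → ℝ)

/-- The characteristic function of the rescaled sample mean in terms of the tilted maps. -/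
lemma charFun_outcomeLaw (ρ : DensityMatrix ι) (m : ℝ) (n : ℕ) (t : ℝ) :
    charFun ((C.outcomeLaw ρ n).toMeasure.map fun w => √n * (sampleMean x n w - m)) t =
      Complex.exp (-(t * √n * Complex.I * m)) *
        ((C.complexTilted x (t * Complex.I / √n) ^ n) ρ.mat).trace := by
  rw [charFun_apply_real, integral_map (Measurable.of_discrete).aemeasurable
    (by fun_prop : Continuous fun y : ℝ => Complex.exp (t * y * Complex.I)).aestronglyMeasurable,
    PMF.integral_eq_sum, ← C.sum_exp_smul_evolve, Matrix.trace_sum, Finset.mul_sum]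
  refine Finset.sum_congr rfl fun w _ => ?_
  have htr := Complex.nonneg_iff.1 (C.evolve_posSemidef n w ρ.posSemidef).trace_nonneg
  have h1 : (((C.evolve n w ρ.mat).trace.re : ℝ) : ℂ) = (C.evolve n w ρ.mat).trace :=
    Complex.ext rfl htr.2
  -- This also holds for `n = 0`, where both sides are `0`.
  have h2 : √(n : ℝ) * (1 / (n : ℝ)) = 1 / √(n : ℝ) := by
    rw [mul_one_div, Real.sqrt_div_self, one_div]
  have h3 : ((√(n : ℝ) : ℝ) : ℂ) * (1 / (n : ℂ)) = 1 / ((√(n : ℝ) : ℝ) : ℂ) := by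
    have := congrArg (fun r : ℝ => (r : ℂ)) h2
    push_cast at this
    exact this
  rw [outcomeLaw, PMF.ofFintype_apply, ENNReal.toReal_ofReal htr.1, Matrix.trace_smul, smul_eq_mul,
    Complex.real_smul, h1, ← mul_assoc, ← Complex.exp_add, mul_comm]
  congr 2
  simp only [sampleMean]
  push_cast
  linear_combination (t * Complex.I * ∑ i, (x (w i) : ℂ)) * h3

end Instrument

end QuantumHMM

/-! ### The limit theorems for the sample mean -/

theorem corollary3 {ι Ω : Type*} [Fintype ι] [Fintype Ω]
    [MeasurableSpace Ω] [MeasurableSingletonClass Ω]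
    (C : QuantumHMM.Instrument Ω ι) (hC : QuantumHMM.IsIrreducible C.total)
    (x : Ω → ℝ) (ρ : QuantumHMM.DensityMatrix ι) :
    -- the derivatives of `φ` at `0` exist, and `φ''(0)` is a variance
    ContDiffAt ℝ 2 (C.phi x) 0 ∧
    0 ≤ deriv (deriv (C.phi x)) 0 ∧
    -- convergence in probability of the sample mean to `φ'(0)`
    (∀ ε : ℝ, 0 < ε →
      Filter.Tendsto
        (fun n : ℕ => (C.outcomeLaw ρ n).toMeasure.real
          {w | ε ≤ |QuantumHMM.sampleMean x n w - deriv (C.phi x) 0|})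
        Filter.atTop (nhds 0)) ∧
    -- convergence in distribution to the centered Gaussian (a Dirac mass if `φ''(0) = 0`)
    MeasureTheory.TendstoInDistribution
      (fun (n : ℕ) (w : Fin n → Ω) =>
        Real.sqrt n * (QuantumHMM.sampleMean x n w - deriv (C.phi x) 0))
      Filter.atTop (id : ℝ → ℝ) (fun n => (C.outcomeLaw ρ n).toMeasure)
      (ProbabilityTheory.gaussianReal 0 (deriv (deriv (C.phi x)) 0).toNNReal) ∧
    -- convergence of the distribution functions
    (0 < deriv (deriv (C.phi x)) 0 → ∀ δ : ℝ,
      Filter.Tendsto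
        (fun n : ℕ => (C.outcomeLaw ρ n).toMeasure.real
          {w | Real.sqrt n * (QuantumHMM.sampleMean x n w - deriv (C.phi x) 0) ≤ δ})
        Filter.atTop
        (nhds (QuantumHMM.stdNormalCDF (δ / Real.sqrt (deriv (deriv (C.phi x)) 0))))) ∧
    -- the degenerate case, where `δ / √φ''(0)` is read as `±∞` for `δ ≠ 0`
    (deriv (deriv (C.phi x)) 0 = 0 → ∀ δ : ℝ, δ ≠ 0 →
      Filter.Tendsto
        (fun n : ℕ => (C.outcomeLaw ρ n).toMeasure.real
          {w | Real.sqrt n * (QuantumHMM.sampleMean x n w - deriv (C.phi x) 0) ≤ δ})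
        Filter.atTop (nhds (if 0 < δ then 1 else 0))) := by
  open QuantumHMM Filter Topology MeasureTheory ProbabilityTheory in
  obtain ⟨ev, hev, hev0, hreal, hasymp⟩ := C.exists_eigenvalue_branch x hC ρ
  have hL : AnalyticAt ℂ (fun z => Complex.log (ev z)) 0 := hev.clog (by simp [hev0])
  have hre : Tendsto (fun θ : ℝ => (θ : ℂ)) (𝓝 0) (𝓝 0) := by
    simpa using Complex.continuous_ofReal.tendsto 0
  have hposre : ∀ᶠ θ : ℝ in 𝓝 0, 0 < (ev θ).re := by
    have := (Complex.continuous_re.tendsto _).comp (hev.continuousAt.tendsto.comp hre)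
    rw [hev0] at this
    exact this.eventually_const_lt (by simp)
  -- Near `0` on the real line `ev` is real and positive, so `log ev` is real there and equals `φ`.
  obtain ⟨hcd, hd1, hd2⟩ := contDiffAt_and_deriv_of_eventuallyEq_re (g := C.phi x) hL
    (by
      filter_upwards [hreal, hposre] with θ h1 h2
      rw [Complex.log_im, Complex.arg_eq_zero_iff]
      exact ⟨h2.le, h1.1⟩)
    (by
      filter_upwards [hreal] with θ h1
      rw [Complex.log_re, Instrument.phi, h1.2])
  set m := deriv (C.phi x) 0
  set v := deriv (deriv (C.phi x)) 0
  let Y : ∀ n : ℕ, (Fin n → Ω) → ℝ := fun n w => √n * (sampleMean x n w - m)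
  have hY : ∀ n, Measurable (Y n) := fun n => Measurable.of_discrete
  have hchar : ∀ t : ℝ, Tendsto (fun n => charFun ((C.outcomeLaw ρ n).toMeasure.map (Y n)) t)
      atTop (𝓝 (Complex.exp (-(v * t ^ 2 / 2)))) := fun t => by
    have h := tendsto_exp_mul_pow hev hev0 t
    rw [← hd1, ← hd2] at h
    refine (hasymp (fun n => t * Complex.I / √n) _ _ ?_ (fun n => ?_) (fun n => ?_) h).congr
      fun n => (C.charFun_outcomeLaw x ρ m n t).symm
    · have h1 : Tendsto (fun n : ℕ => ‖(t * Complex.I : ℂ)‖ / √(n : ℝ)) atTop (𝓝 0) :=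
        tendsto_const_nhds.div_atTop
          (Real.tendsto_sqrt_atTop.comp tendsto_natCast_atTop_atTop)
      refine squeeze_zero_norm (fun n => ?_) h1
      simp [abs_of_nonneg]
    · simp [Complex.div_ofReal_re]
    · rw [Complex.norm_exp]
      simp [← Complex.ofReal_mul]
  have hprob : ∀ n, IsProbabilityMeasure ((C.outcomeLaw ρ n).toMeasure.map (Y n)) := fun n =>
    Measure.isProbabilityMeasure_map (hY n).aemeasurable
  -- Characteristic functions have modulus at most one, hence so does their limit `exp (-v / 2)` at
  -- `t = 1`.
  have hv : 0 ≤ v := by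
    have h := le_of_tendsto (hchar 1).norm (Eventually.of_forall fun n => norm_charFun_le_one 1)
    rw [Complex.norm_exp, Real.exp_le_one_iff] at h
    have h' : 0 ≤ v / 2 := by simpa [← Complex.ofReal_neg] using h
    linarith
  have hdist : TendstoInDistribution Y atTop (id : ℝ → ℝ) (fun n => (C.outcomeLaw ρ n).toMeasure)
      (gaussianReal 0 v.toNNReal) := by
    refine tendstoInDistribution_id_of_tendsto_charFun hY fun t => ?_
    rw [charFun_gaussianReal]
    convert hchar t using 3
    simp [Real.coe_toNNReal v hv]
  refine ⟨hcd, hv, fun ε hε => ?_, hdist, fun hv0 δ => ?_, fun hv0 δ hδ => ?_⟩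
  -- A deviation of at least `ε` becomes one of at least `√n ε` after rescaling; halving `ε` gives
  -- the strict inequality of the tightness bound.
  · have hr : Tendsto (fun n : ℕ => √(n : ℝ) * (ε / 2)) atTop atTop :=
      (Real.tendsto_sqrt_atTop.comp tendsto_natCast_atTop_atTop).atTop_mul_const (half_pos hε)
    have h := tendsto_measureReal_abs_ge_of_tendsto_charFun (by fun_prop) hY hchar hr
    refine squeeze_zero' (Eventually.of_forall fun n => measureReal_nonneg) ?_ h
    filter_upwards [eventually_gt_atTop 0] with n hn
    refine measureReal_mono fun w hw => ?_
    have hn' : 0 < √(n : ℝ) := Real.sqrt_pos.2 (Nat.cast_pos.2 hn)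
    have hw' : ε ≤ |sampleMean x n w - m| := hw
    change √(n : ℝ) * (ε / 2) < |√n * (sampleMean x n w - m)|
    rw [abs_mul, abs_of_pos hn']
    exact mul_lt_mul_of_pos_left (by linarith) hn'
  · have hne : v.toNNReal ≠ 0 := (Real.toNNReal_pos.2 hv0).ne'
    have := nullSingletonClass_gaussianReal (μ := 0) hne
    rw [← gaussianReal_real_Iic hv0]
    exact tendsto_measureReal_le_of_tendstoInDistribution hY hdist (measure_singleton δ)
  · have hν : gaussianReal 0 v.toNNReal = Measure.dirac 0 := by
      rw [hv0, Real.toNNReal_zero, gaussianReal_zero_var]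
    -- The limit law is the Dirac mass at `0`, for which `{δ}` is null because `δ ≠ 0`.
    have h := tendsto_measureReal_le_of_tendstoInDistribution hY hdist (δ := δ) (by
      rw [hν]
      simp [hδ.symm])
    convert h using 2
    rw [hν, Measure.real, Measure.dirac_apply' _ measurableSet_Iic]
    rcases lt_or_gt_of_ne hδ with h0 | h0
    · simp [h0.not_ge, h0.not_gt]
    · simp [h0.le, h0]
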